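/- For a nonnegative integer $m$ let $$P_m(a)=2^{-2m}\sum_{k=0}^{m}2^k\binom{2m-2k}{m-k}\binom{m+k}{k}(a+1)^k$$ be the Boros–Moll polynomial, and for $0\le i\le m$ let $d_i(m)$ be the coefficient of $a^i$ in $P_m(a)$; set $d_i(m)=0$ for $i<0$ and for $i>m$. Then for all integers $m$ and $i$ with $1\le i\le m-1$ we have $d_i(m)^2-d_{i-1}(m)d_{i+1}(m)>0$ and $$\frac{d_{i-1}(m)^2-d_{i-2}(m)\,d_i(m)}{d_i(m)^2-d_{i-1}(m)\,d_{i+1}(m)}<\frac{(i+1)(i+2)(m+i+3)^2}{(m+1-i)(m+2-i)(m+i+2)^2}.$$ -/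

import Mathlib

/-- The Boros-Moll polynomial
`P_m(a) = 2^{-2m} ∑_{k=0}^m 2^k * C(2m-2k, m-k) * C(m+k, k) * (a+1)^k`. -/
noncomputable def borosMoll (m : ℕ) : Polynomial ℝ :=
  Polynomial.C (((2 : ℝ) ^ (2 * m))⁻¹) *
    ∑ k ∈ Finset.range (m + 1),
      Polynomial.C ((2 : ℝ) ^ k * ((2 * m - 2 * k).choose (m - k) : ℝ) * ((m + k).choose k : ℝ)) *
        (Polynomial.X + 1) ^ k

/-- `borosMollCoeff m i` is the coefficient `d_i(m)` of `a^i` in `P_m(a)`, with the usual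
convention `d_i(m) = 0` for negative `i` (and `d_i(m) = 0` for `i > m`, by the degree of `P_m`). -/
noncomputable def borosMollCoeff (m : ℕ) (i : ℤ) : ℝ :=
  if i < 0 then 0 else (borosMoll m).coeff i.toNat

/-!
Write `d i` for the coefficients and set `q = m - i`. The polynomial `P_m` satisfies the Jacobi
differential equation `(1 - a²) P'' - (2 a + 2 m + 1) P' + m (m + 1) P = 0` (`borosMoll_ode`); in
powers of `a + 1` it is the two-term recurrence of the hypergeometric coefficients, and in powers of
`a` it is the three-term recurrence `borosMollCoeff_recurrence`. The recurrence expresses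
`d (i - 2)` and `d (i + 1)` through `d (i - 1)` and `d i`. With

  `d (i - 1) / d i = i s / ((m + i) (q + 1))`

the claim becomes the positivity of a quadratic polynomial in `s` (`defect`), which does not hold
for all `s`: the ratio of consecutive coefficients has to be located rather sharply. With constant
coefficients the recurrence would have the fixed point `s = m + i + 1`, so put `s = m + i + 1 + x`.
It then reads `x_i = q (1 + x_{i+1}) / (m + i + 2 + x_{i+1})` with `x_m = 0`, an increasing function
of `x_{i+1}`, and downward induction on `i` gives (`ratio_bounds`)

  `i q / (2 (i² + i + m)) ≤ x_i ≤ q / (2 (i + 1))`.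

On this interval the quadratic polynomial is positive because its three Bernstein coefficients are
polynomials in `i - 1` and `q - 1` without negative coefficients (`defect_pos`). The lower bound
`x ≥ 0` alone does not suffice when `i` is of the order of `m`, and some upper bound is needed
because for small `i` both roots of the quadratic polynomial may lie to the right of `x_i`.
-/

/-! ### The differential equation and the recurrence -/

/-- The coefficients of the Boros–Moll polynomial in powers of `a + 1`, up to the factor `4⁻ᵐ`. -/
noncomputable def shiftedCoeff (m k : ℕ) : ℝ :=
  2 ^ k * ((2 * m - 2 * k).choose (m - k) : ℝ) * ((m + k).choose k : ℝ)

theorem shiftedCoeff_pos {m k : ℕ} (hk : k ≤ m) : 0 < shiftedCoeff m k := by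
  have h1 : 0 < (2 * m - 2 * k).choose (m - k) := Nat.choose_pos (by omega)
  have h2 : 0 < (m + k).choose k := Nat.choose_pos (by omega)
  unfold shiftedCoeff
  positivity

theorem shiftedCoeff_succ {m k : ℕ} (hk : k < m) :
    ((m : ℝ) - k) * (m + k + 1) * shiftedCoeff m k =
      (k + 1) * (2 * m - 1 - 2 * k) * shiftedCoeff m (k + 1) := by
  obtain ⟨n, rfl⟩ : ∃ n, m = k + 1 + n := ⟨m - (k + 1), by omega⟩
  -- In terms of `n = m - (k + 1)` both factors are handled by one-step binomial identities.
  have h1 : ((n : ℝ) + 1) * Nat.centralBinom (n + 1) = 2 * (2 * n + 1) * Nat.centralBinom n := by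
    exact_mod_cast Nat.succ_mul_centralBinom_succ n
  have h2 : ((k : ℝ) + 1) * (k + 1 + n + (k + 1)).choose (k + 1) =
      (k + 1 + n + k + 1) * (k + 1 + n + k).choose k := by
    have := Nat.add_one_mul_choose_eq (k + 1 + n + k) k
    have h : ((k + 1 + n + k + 1 : ℕ) : ℝ) * (k + 1 + n + k).choose k =
      (k + 1 + n + (k + 1)).choose (k + 1) * ((k + 1 : ℕ) : ℝ) := by exact_mod_cast this
    push_cast at h
    linarith
  have e1 : 2 * (k + 1 + n) - 2 * k = 2 * (n + 1) := by omega
  have e2 : k + 1 + n - k = n + 1 := by omega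
  have e3 : 2 * (k + 1 + n) - 2 * (k + 1) = 2 * n := by omega
  have e4 : k + 1 + n - (k + 1) = n := by omega
  unfold shiftedCoeff
  rw [e1, e2, e3, e4, ← Nat.centralBinom_eq_two_mul_choose, ← Nat.centralBinom_eq_two_mul_choose]
  push_cast
  linear_combination ((k + 1 + n + k).choose k : ℝ) * (k + 1 + n + k + 1) * 2 ^ k * h1 -
    2 ^ k * 2 * (2 * n + 1) * (Nat.centralBinom n : ℝ) * h2

open Polynomial in
theorem borosMoll_eq_comp (m : ℕ) :
    borosMoll m = (C (((2 : ℝ) ^ (2 * m))⁻¹) *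
      ∑ k ∈ Finset.range (m + 1), C (shiftedCoeff m k) * X ^ k).comp (X + 1) := by
  simp only [borosMoll, shiftedCoeff, mul_comp, C_comp, sum_comp, X_pow_comp]

open Polynomial in
/-- The hypergeometric recurrence of the coefficients, read as a differential equation. -/
theorem sum_shiftedCoeff_ode (m : ℕ) (Q : ℝ[X])
    (hQ : Q = ∑ k ∈ Finset.range (m + 1), C (shiftedCoeff m k) * X ^ k) :
    X * (2 - X) * derivative (derivative Q) - (2 * X + C (2 * (m : ℝ) - 1)) * derivative Q +
      C ((m : ℝ) * (m + 1)) * Q = 0 := by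
  have hc : ∀ n, Q.coeff n = if n ≤ m then shiftedCoeff m n else 0 := by
    intro n
    simp [hQ, Polynomial.coeff_X_pow]
  have key : ∀ n : ℕ, ((m : ℝ) - n) * (m + n + 1) * Q.coeff n =
      (n + 1) * (2 * m - 1 - 2 * n) * Q.coeff (n + 1) := by
    intro n
    rw [hc, hc]
    rcases lt_trichotomy n m with h | rfl | h
    · rw [if_pos h.le, if_pos (by omega : n + 1 ≤ m)]
      exact shiftedCoeff_succ h
    · simp
    · rw [if_neg (by omega), if_neg (by omega)]
      simp
  have e : X * (2 - X) * derivative (derivative Q) - (2 * X + C (2 * (m : ℝ) - 1)) * derivative Q +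
      C ((m : ℝ) * (m + 1)) * Q = X * (C 2 * derivative (derivative Q)) -
        X * (X * derivative (derivative Q)) - X * (C 2 * derivative Q) -
        C (2 * (m : ℝ) - 1) * derivative Q + C ((m : ℝ) * (m + 1)) * Q := by
    rw [show (C 2 : ℝ[X]) = 2 from rfl]
    ring
  rw [e]
  ext n
  rcases n with _ | _ | n
  · have := key 0
    simp [Polynomial.coeff_derivative] at this ⊢
    linarith
  · have := key 1
    simp only [Polynomial.coeff_add, Polynomial.coeff_sub, Polynomial.coeff_X_mul,
      Polynomial.coeff_C_mul, Polynomial.coeff_derivative, Polynomial.coeff_zero] at this ⊢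
    simp only [Polynomial.coeff_X_mul_zero]
    push_cast at this ⊢
    linarith
  · have := key (n + 2)
    simp only [Polynomial.coeff_add, Polynomial.coeff_sub, Polynomial.coeff_X_mul,
      Polynomial.coeff_C_mul, Polynomial.coeff_derivative, Polynomial.coeff_zero] at this ⊢
    push_cast at this ⊢
    linarith

open Polynomial in
theorem borosMoll_ode (m : ℕ) :
    (1 - X ^ 2) * derivative (derivative (borosMoll m)) -
      (2 * X + C (2 * (m : ℝ) + 1)) * derivative (borosMoll m) +
      C ((m : ℝ) * (m + 1)) * borosMoll m = 0 := by
  obtain ⟨Q, hQ⟩ : ∃ Q, Q = ∑ k ∈ Finset.range (m + 1), C (shiftedCoeff m k) * X ^ k := ⟨_, rfl⟩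
  have h := congrArg (fun R : ℝ[X] => R.comp (X + 1)) (sum_shiftedCoeff_ode m Q hQ)
  rw [borosMoll_eq_comp, ← hQ]
  simp [Polynomial.derivative_comp] at h ⊢
  linear_combination C (((2 : ℝ) ^ (2 * m))⁻¹) * h

theorem borosMoll_coeff_eq_sum (m n : ℕ) :
    (borosMoll m).coeff n =
      ((2 : ℝ) ^ (2 * m))⁻¹ * ∑ k ∈ Finset.range (m + 1), shiftedCoeff m k * k.choose n := by
  simp only [borosMoll, Polynomial.coeff_C_mul, Polynomial.finsetSum_coeff,
    Polynomial.coeff_X_add_one_pow, shiftedCoeff]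

theorem borosMollCoeff_pos {m : ℕ} {i : ℤ} (h0 : 0 ≤ i) (him : i ≤ m) :
    0 < borosMollCoeff m i := by
  obtain ⟨n, rfl⟩ := Int.eq_ofNat_of_zero_le h0
  rw [borosMollCoeff, if_neg (by omega), Int.toNat_natCast, borosMoll_coeff_eq_sum]
  refine mul_pos (by positivity) (Finset.sum_pos' (fun k hk => ?_) ⟨m, by simp, ?_⟩)
  · exact mul_nonneg (shiftedCoeff_pos (by simpa [Nat.lt_succ_iff] using hk)).le (by positivity)
  · exact mul_pos (shiftedCoeff_pos le_rfl)
      (by exact_mod_cast Nat.choose_pos (by exact_mod_cast him))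

theorem borosMollCoeff_of_gt {m : ℕ} {i : ℤ} (him : (m : ℤ) < i) : borosMollCoeff m i = 0 := by
  obtain ⟨n, rfl⟩ := Int.eq_ofNat_of_zero_le (by omega : 0 ≤ i)
  rw [borosMollCoeff, if_neg (by omega), Int.toNat_natCast, borosMoll_coeff_eq_sum,
    Finset.sum_eq_zero, mul_zero]
  intro k hk
  rw [Finset.mem_range] at hk
  rw [Nat.choose_eq_zero_of_lt (by omega)]
  simp

theorem borosMollCoeff_of_neg {m : ℕ} {i : ℤ} (hi : i < 0) : borosMollCoeff m i = 0 :=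
  if_pos hi

theorem borosMollCoeff_natCast (m n : ℕ) :
    borosMollCoeff m n = (borosMoll m).coeff n := by
  simp [borosMollCoeff]

open Polynomial in
theorem borosMollCoeff_recurrence (m : ℕ) (i : ℤ) :
    ((m : ℝ) + 1 - i) * (m + i) * borosMollCoeff m (i - 1) -
      i * (2 * m + 1) * borosMollCoeff m i + i * (i + 1) * borosMollCoeff m (i + 1) = 0 := by
  rcases lt_trichotomy i 0 with h | rfl | h
  · rw [borosMollCoeff_of_neg h, borosMollCoeff_of_neg (by omega : i - 1 < 0)]
    rcases eq_or_ne i (-1) with rfl | h'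
    · simp
    · rw [borosMollCoeff_of_neg (by omega : i + 1 < 0)]
      simp
  · rw [borosMollCoeff_of_neg (by omega : (0 : ℤ) - 1 < 0)]
    simp
  · obtain ⟨n, rfl⟩ : ∃ n : ℕ, i = n + 1 := ⟨(i - 1).toNat, by omega⟩
    have e := borosMoll_ode m
    obtain ⟨R, hR⟩ : ∃ R, R = borosMoll m := ⟨_, rfl⟩
    rw [show (n : ℤ) + 1 - 1 = (n : ℕ) by omega, show (n : ℤ) + 1 + 1 = (n + 2 : ℕ) by omega,
      show (n : ℤ) + 1 = (n + 1 : ℕ) by omega, borosMollCoeff_natCast, borosMollCoeff_natCast,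
      borosMollCoeff_natCast]
    rw [← hR] at e ⊢
    have e' : derivative (derivative R) - X * (X * derivative (derivative R)) -
        X * (C 2 * derivative R) - C (2 * (m : ℝ) + 1) * derivative R +
        C ((m : ℝ) * (m + 1)) * R = 0 := by
      rw [← e, show (C 2 : ℝ[X]) = 2 from rfl]
      ring
    have key := congrArg (fun S : ℝ[X] => S.coeff n) e'
    rcases n with _ | _ | n
    · simp [Polynomial.coeff_derivative] at key ⊢
      linarith
    · simp only [Polynomial.coeff_add, Polynomial.coeff_sub, Polynomial.coeff_X_mul,
        Polynomial.coeff_C_mul, Polynomial.coeff_derivative, Polynomial.coeff_zero,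
        Polynomial.coeff_X_mul_zero] at key
      push_cast at key ⊢
      linarith
    · simp only [Polynomial.coeff_add, Polynomial.coeff_sub, Polynomial.coeff_X_mul,
        Polynomial.coeff_C_mul, Polynomial.coeff_derivative, Polynomial.coeff_zero] at key
      push_cast at key ⊢
      linarith

/-! ### Bounds for the ratio of consecutive coefficients -/

/-- The lower bound `i q / (2 (i² + i + m))`, `m = i + q`, is a subsolution of the recurrence
`x_i = q (1 + x_{i+1}) / (q + 2 i + 2 + x_{i+1})`. -/
theorem step_lower {i q x : ℝ} (hi : 1 ≤ i) (hq : 1 ≤ q)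
    (h : (q - 1) * (i + 1) ≤ 2 * ((i + 1) ^ 2 + (i + 1) + (q + i)) * x) :
    q * i * (q + 2 * i + 2 + x) ≤ 2 * (i ^ 2 + i + (q + i)) * (q * (1 + x)) := by
  have hW : 0 < 2 * ((i + 1) ^ 2 + (i + 1) + (q + i)) := by positivity
  have hc : 0 ≤ 2 * (i ^ 2 + i + (q + i)) * q - q * i := by nlinarith
  have key : 0 ≤ 2 * ((i + 1) ^ 2 + (i + 1) + (q + i)) *
      (2 * (i ^ 2 + i + (q + i)) * q - q * i * (q + 2 * i + 2)) +
      (2 * (i ^ 2 + i + (q + i)) * q - q * i) * ((q - 1) * (i + 1)) := by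
    obtain ⟨j, rfl⟩ : ∃ j, i = j + 1 := ⟨i - 1, by ring⟩
    obtain ⟨k, rfl⟩ : ∃ k, q = k + 1 := ⟨q - 1, by ring⟩
    have hj : 0 ≤ j := by linarith
    have hk : 0 ≤ k := by linarith
    ring_nf
    positivity
  -- The claim is linear in `x` with slope `hc`, so the least admissible `x` (which is `key`)
  -- is the worst case.
  have := mul_le_mul_of_nonneg_left h hc
  refine sub_nonneg.1 (nonneg_of_mul_nonneg_right ?_ hW)
  linarith

/-- The upper bound `q / (2 (i + 1))` is a supersolution of the recurrence
`x_i = q (1 + x_{i+1}) / (q + 2 i + 2 + x_{i+1})`. -/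
theorem step_upper {i q x : ℝ} (hi : 1 ≤ i) (hq : 1 ≤ q)
    (h : 2 * (i + 2) * x ≤ q - 1) :
    2 * (i + 1) * (q * (1 + x)) ≤ q * (q + 2 * i + 2 + x) := by
  have hq' : 0 ≤ q * (2 * i + 1) := by nlinarith
  have := mul_le_mul_of_nonneg_left h hq'
  have h2 : 0 < 2 * (i + 2) := by linarith
  refine sub_nonneg.1 (nonneg_of_mul_nonneg_right ?_ h2)
  nlinarith

/-- Location of the ratio `d (i - 1) / d i`, for `n = m - i`, by downward induction on `i`. -/
theorem ratio_bounds (m n : ℕ) : ∀ i : ℤ, 1 ≤ i → (m : ℤ) = i + n →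
    ∃ x : ℝ, (n : ℝ) * i ≤ 2 * ((i : ℝ) ^ 2 + i + m) * x ∧ 2 * ((i : ℝ) + 1) * x ≤ n ∧
      ((m : ℝ) + i) * (n + 1) * borosMollCoeff m (i - 1) =
        i * (m + i + 1 + x) * borosMollCoeff m i := by
  induction n with
  | zero =>
    intro i hi hm
    obtain rfl : i = m := by simpa using hm.symm
    refine ⟨0, by simp, by simp, ?_⟩
    have := borosMollCoeff_recurrence m m
    rw [borosMollCoeff_of_gt (by omega : (m : ℤ) < m + 1)] at this
    push_cast at this ⊢
    linarith
  | succ n ih =>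
    intro i hi hm
    obtain ⟨y, hy1, hy2, hy⟩ := ih (i + 1) (by omega) (by push_cast at hm; omega)
    have hm' : (m : ℝ) = i + (n + 1) := by exact_mod_cast hm
    have hi' : (1 : ℝ) ≤ i := by exact_mod_cast hi
    have hn : (0 : ℝ) ≤ n := by positivity
    have hrec := borosMollCoeff_recurrence m i
    have hy0 : 0 ≤ y := by
      push_cast at hy1
      have h1 : 0 ≤ (n : ℝ) * (i + 1) := by positivity
      exact nonneg_of_mul_nonneg_right (h1.trans hy1) (by positivity)
    have hD : 0 < (m : ℝ) + i + 2 + y := by positivity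
    refine ⟨(n + 1) * (1 + y) / (m + i + 2 + y), ?_, ?_, ?_⟩
    · rw [mul_div_assoc', le_div_iff₀ hD]
      have := step_lower (i := i) (q := n + 1) (x := y) hi' (by linarith)
        (by push_cast at hy1; rw [hm'] at hy1; linarith)
      push_cast
      rw [hm']
      linarith
    · rw [mul_div_assoc', div_le_iff₀ hD]
      have := step_upper (i := i) (q := n + 1) (x := y) hi' (by linarith)
        (by push_cast at hy2; linarith)
      push_cast
      rw [hm']
      linarith
    · rw [show i + 1 - 1 = i by ring] at hy
      push_cast at hy ⊢
      rw [hm'] at hy hrec hD ⊢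
      have hnz := hD.ne'
      have : (i : ℝ) * (i + 1) * borosMollCoeff m (i + 1) =
          i * (((i : ℝ) + (n + 1) + (i + 1)) * (n + 1) * borosMollCoeff m i) /
            (i + (n + 1) + i + 2 + y) := by
        rw [eq_div_iff hnz, hy]; ring
      rw [this] at hrec
      field_simp at hrec ⊢
      linarith

/-! ### The quadratic inequality -/

/-- The difference of the two sides of the claim, with denominators cleared and divided by `d i ^ 2`,
as a function of `i`, `q = m - i` and `s = (m + i) (q + 1) d (i - 1) / (i d i)`. -/
def defect (i q s : ℝ) : ℝ :=
  (i + 2) * (q + 2 * i + 3) ^ 2 * (q + 2 * i) * (q + 2 * i - 1) *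
      ((i + 1) * (q + 2 * i) * (q + 1) - i * s * (2 * q + 2 * i + 1 - s)) -
    i * (q + 2 * i + 2) ^ 2 *
      (i * s ^ 2 * (q + 2) * (q + 2 * i - 1) -
        (i - 1) * (2 * q + 2 * i + 1) * s * (q + 2 * i) * (q + 1) +
        (i - 1) * (q + 2 * i) ^ 2 * (q + 1) ^ 2)

theorem defect_pos {i q x : ℝ} (hi : 1 ≤ i) (hq : 1 ≤ q)
    (hl : q * i ≤ 2 * (i ^ 2 + i + (i + q)) * x) (hu : 2 * (i + 1) * x ≤ q) :
    0 < defect i q (q + 2 * i + 1 + x) := by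
  obtain ⟨A, B, C, hA, hB, hC⟩ : ∃ A B C : ℝ,
      A = i * (i + 2) * (q + 2 * i + 3) ^ 2 * (q + 2 * i) * (q + 2 * i - 1) -
        i ^ 2 * (q + 2 * i + 2) ^ 2 * (q + 2) * (q + 2 * i - 1) ∧
      B = 2 * A * (q + 2 * i + 1) -
        i * (i + 2) * (q + 2 * i + 3) ^ 2 * (q + 2 * i) * (q + 2 * i - 1) * (2 * q + 2 * i + 1) +
        i * (q + 2 * i + 2) ^ 2 * (i - 1) * (2 * q + 2 * i + 1) * (q + 2 * i) * (q + 1) ∧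
      C = defect i q (q + 2 * i + 1) := ⟨_, _, _, rfl, rfl, rfl⟩
  have hquad : defect i q (q + 2 * i + 1 + x) = A * x ^ 2 + B * x + C := by
    rw [hC, hB, hA]
    unfold defect
    ring
  obtain ⟨vd, hvd⟩ : ∃ v, v = 2 * (i ^ 2 + i + (i + q)) := ⟨_, rfl⟩
  obtain ⟨ud, hud⟩ : ∃ v, v = 2 * (i + 1) := ⟨_, rfl⟩
  -- The Bernstein coefficients of the quadratic polynomial on the interval with the end points
  -- `q * i / vd` and `q / ud`, up to positive factors.
  have hpos : 0 < A * (q * i) ^ 2 + B * (q * i) * vd + C * vd ^ 2 ∧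
      0 < 2 * A * (q * i) * q + B * (q * i * ud + q * vd) + 2 * C * vd * ud ∧
      0 < A * q ^ 2 + B * q * ud + C * ud ^ 2 := by
    rw [hC, hB, hA, hvd, hud]
    clear hquad hC hB hA hvd hud hl hu
    obtain ⟨j, rfl⟩ : ∃ j, i = j + 1 := ⟨i - 1, by ring⟩
    obtain ⟨k, rfl⟩ : ∃ k, q = k + 1 := ⟨q - 1, by ring⟩
    have hj : 0 ≤ j := by linarith
    have hk : 0 ≤ k := by linarith
    unfold defect
    -- No negative coefficient remains after expansion in `j` and `k`.
    refine ⟨?_, ?_, ?_⟩ <;> ring_nf <;> positivity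
  obtain ⟨h1, h2, h3⟩ := hpos
  rw [← hvd] at hl
  rw [← hud] at hu
  obtain ⟨u, hu'⟩ : ∃ u, u = q - ud * x := ⟨_, rfl⟩
  obtain ⟨v, hv'⟩ : ∃ v, v = vd * x - q * i := ⟨_, rfl⟩
  have hu0 : 0 ≤ u := by linarith
  have hv0 : 0 ≤ v := by linarith
  have hw : 0 < ud * v + vd * u := by
    have : ud * v + vd * u = 2 * q * (q + i) := by
      rw [hu', hv', hvd, hud]; ring
    rw [this]; positivity
  have hid : (ud * v + vd * u) ^ 2 * defect i q (q + 2 * i + 1 + x) =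
      (A * (q * i) ^ 2 + B * (q * i) * vd + C * vd ^ 2) * u ^ 2 +
      (2 * A * (q * i) * q + B * (q * i * ud + q * vd) + 2 * C * vd * ud) * (u * v) +
      (A * q ^ 2 + B * q * ud + C * ud ^ 2) * v ^ 2 := by
    rw [hquad, hu', hv']; ring
  refine pos_of_mul_pos_right ?_ (sq_nonneg (ud * v + vd * u))
  rw [hid]
  rcases hu0.eq_or_lt with h | h
  · have hv : 0 < v := by
      rcases hv0.eq_or_lt with h' | h'
      · rw [← h, ← h'] at hw; simp at hw
      · exact h'
    positivity
  · positivity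

/-- The positivity behind `d i ^ 2 - d (i - 1) * d (i + 1) > 0`, in the notation of `defect` with
`s = m + i + 1 + x`; here `x ≥ 0` is enough. -/
theorem gap_pos {i q x : ℝ} (hi : 1 ≤ i) (hq : 1 ≤ q) (hx : 0 ≤ x) :
    0 < (i + 1) * (q + 2 * i) * (q + 1) -
      i * (q + 2 * i + 1 + x) * (2 * q + 2 * i + 1 - (q + 2 * i + 1 + x)) := by
  have : (i + 1) * (q + 2 * i) * (q + 1) -
      i * (q + 2 * i + 1 + x) * (2 * q + 2 * i + 1 - (q + 2 * i + 1 + x)) =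
      2 * i ^ 2 + q ^ 2 + 2 * q * i + q + 2 * i + i * x * (2 * i + 1) + i * x ^ 2 := by ring
  rw [this]
  positivity

theorem theorem1p6 (m : ℕ) (i : ℤ) (hi : 1 ≤ i) (him : i ≤ (m : ℤ) - 1) :
    0 < borosMollCoeff m i ^ 2 - borosMollCoeff m (i - 1) * borosMollCoeff m (i + 1) ∧
    (borosMollCoeff m (i - 1) ^ 2 - borosMollCoeff m (i - 2) * borosMollCoeff m i) /
        (borosMollCoeff m i ^ 2 - borosMollCoeff m (i - 1) * borosMollCoeff m (i + 1)) <
      (((i : ℝ) + 1) * ((i : ℝ) + 2) * ((m : ℝ) + (i : ℝ) + 3) ^ 2) /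
        (((m : ℝ) + 1 - (i : ℝ)) * ((m : ℝ) + 2 - (i : ℝ)) * ((m : ℝ) + (i : ℝ) + 2) ^ 2) := by
  obtain ⟨n, hn⟩ : ∃ n : ℕ, (m : ℤ) = i + n := ⟨(m - i).toNat, by omega⟩
  obtain ⟨x, hl, hu, hx⟩ := ratio_bounds m n i hi hn
  have hd : 0 < borosMollCoeff m i := borosMollCoeff_pos (by omega) (by omega)
  have hr1 := borosMollCoeff_recurrence m i
  have hr2 := borosMollCoeff_recurrence m (i - 1)
  rw [show i - 1 - 1 = i - 2 by ring, show i - 1 + 1 = i by ring] at hr2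
  push_cast at hr2
  generalize borosMollCoeff m (i - 2) = b at *
  generalize borosMollCoeff m (i - 1) = a at *
  generalize borosMollCoeff m i = d at *
  generalize borosMollCoeff m (i + 1) = c at *
  have hmr : (m : ℝ) = i + n := by exact_mod_cast hn
  have hir : (1 : ℝ) ≤ i := by exact_mod_cast hi
  have hnr : (1 : ℝ) ≤ n := by
    have : (1 : ℤ) ≤ n := by omega
    exact_mod_cast this
  rw [hmr] at hl hx hr1 hr2 ⊢
  generalize (i : ℝ) = i at *
  generalize (n : ℝ) = q at *
  have hx0 : 0 ≤ x := nonneg_of_mul_nonneg_right (le_trans (by positivity) hl) (by positivity)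
  have hG := defect_pos hir hnr hl hu
  have hE := gap_pos hir hnr hx0
  obtain ⟨s, hs⟩ : ∃ s, s = q + 2 * i + 1 + x := ⟨_, rfl⟩
  rw [← hs] at hG hE
  have hp : 0 < q + 2 * i := by positivity
  have hp1 : 0 < q + 2 * i - 1 := by linarith
  have hi0 : 0 < i := by linarith
  have hc : c = (2 * q + 2 * i + 1 - s) * d / (i + 1) := by
    rw [eq_div_iff (by positivity)]
    refine mul_left_cancel₀ hi0.ne' ?_
    rw [hs]
    linear_combination hr1 - hx
  have ha : a = i * s * d / ((q + 2 * i) * (q + 1)) := by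
    rw [eq_div_iff (by positivity), hs]
    linear_combination hx
  have hb : b = (i - 1) * ((2 * q + 2 * i + 1) * a - i * d) / ((q + 2) * (q + 2 * i - 1)) := by
    rw [eq_div_iff (by positivity)]
    linear_combination hr2
  have hden : (q + 2 * i) * (q + 1) * (i + 1) * (d ^ 2 - a * c) = d ^ 2 *
      ((i + 1) * (q + 2 * i) * (q + 1) - i * s * (2 * q + 2 * i + 1 - s)) := by
    rw [hc, ha]
    field_simp
  have hdpos : 0 < d ^ 2 - a * c := by
    refine pos_of_mul_pos_right (a := (q + 2 * i) * (q + 1) * (i + 1)) ?_ (by positivity)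
    rw [hden]
    positivity
  refine ⟨hdpos, ?_⟩
  rw [show i + q + 1 - i = q + 1 by ring, show i + q + 2 - i = q + 2 by ring,
    show i + q + i + 3 = q + 2 * i + 3 by ring, show i + q + i + 2 = q + 2 * i + 2 by ring,
    div_lt_div_iff₀ hdpos (by positivity), ← sub_pos]
  have hid : (q + 2 * i) ^ 2 * (q + 1) * (q + 2 * i - 1) *
      ((i + 1) * (i + 2) * (q + 2 * i + 3) ^ 2 * (d ^ 2 - a * c) -
        (a ^ 2 - b * d) * ((q + 1) * (q + 2) * (q + 2 * i + 2) ^ 2)) =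
      d ^ 2 * defect i q s := by
    rw [hb, hc, ha]
    unfold defect
    field_simp
    ring
  refine pos_of_mul_pos_right
    (a := (q + 2 * i) ^ 2 * (q + 1) * (q + 2 * i - 1)) ?_ (by positivity)
  rw [hid]
  positivity
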